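/- Let $\mathbf C$ be a category with finite coproducts. For a functor $F:\mathbf C\to\mathbf C$ such that the final coalgebra $F^\nu X=\nu\gamma.\,F(X+\gamma)$ exists for every object $X$ (then $F$ is called *1-iteratable*, and $F^\nu$ is again an endofunctor), write $\mathsf{out}:F^\nu X\to F(X+F^\nu X)$ for the (invertible) structure map and $\mathsf{coit}\,f:A\to F^\nu X$ for the unique coalgebra morphism from $(A,f:A\to F(X+A))$. $F$ is *$(n+1)$-iteratable* if $F^\nu$ exists and is $n$-iteratable, and *$\omega$-iteratable* if it is $n$-iteratable for all $n\ge 1$; a monad is $\omega$-iteratable if its underlying functor is. For a monad $S=(S,\eta,(-)^\star)$ (in Kleisli form) that is 1-iteratable, $S^\nu$ is the monad with unit $\eta^\nu=\mathsf{out}^{-1}\,\eta\,\mathsf{inl}$ and Kleisli lifting $f^{\ast}$ (for $f:X\to S^\nu Y$) determined by $\mathsf{out}\,f^{\ast}=[\mathsf{out}\,f,\ \eta\,\mathsf{inr}\,f^{\ast}]^\star\,\mathsf{out}$. A monad morphism $\alpha:S\to T$ induces the monad morphism $\alpha^\nu=\mathsf{coit}(\alpha\,\mathsf{out}):S^\nu\to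 T^\nu$. This gives an endofunctor $(-)^\nu$ of the category of $\omega$-iteratable monads over $\mathbf C$ and monad morphisms. Let $\rhd=\mathsf{out}^{-1}\,\eta\,\mathsf{inr}:S^\nu\to S^\nu$ be the delay transformation. A (complete) *Elgot monad* is a monad $S$ with an operator assigning to each $f:X\to S(Y+X)$ a morphism $f^\dagger:X\to SY$ such that - (fixpoint) $f^\dagger=[\eta,f^\dagger]^\star f$; - (naturality) $g^\star f^\dagger=([(S\,\mathsf{inl})\,g,\ \eta\,\mathsf{inr}]^\star f)^\dagger$ for $g:Y\to SZ$; - (codiagonal) $(S[\mathrm{id},\mathsf{inr}]\,f)^\dagger=f^{\dagger\dagger}$ for $f:X\to S((Y+X)+X)$; - (uniformity) $f\,h=S(\mathrm{id}+h)\,g$ implies $f^\dagger h=g^\dagger$, for $f:X\to S(Y+X)$, $g:Z\to S(Y+Z)$, $h:Z\to X$. A morphism of Elgot monads is a monad morphism $\alpha$ with $\alpha f^\dagger=(\alpha f)^\dagger$ for all $f:X\to S(Y+X)$. **Theorem.** (1) The functor $(-)^\nu$ on the category of $\omega$-iteratable monads over $\mathbf C$ is a monad, with unit having components $\mathsf{out}^{-1}\,(S\,\mathsf{inl}):SX\to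 S^\nu X$ and multiplication having components $\mathsf{coit}(S[\mathrm{id},\mathsf{inr}\,\mathsf{out}^{-1}]\,\mathsf{out}\,\mathsf{out}):S^{\nu\nu}X\to S^\nu X$. (2) The category of $\omega$-iteratable Elgot monads over $\mathbf C$ is isomorphic to the full subcategory of the category of (Eilenberg–Moore) $(-)^\nu$-algebras $(S,\rho:S^\nu\to S)$ consisting of those that satisfy delay cancellation $\rho\,\rhd=\rho$. Specifically, an isomorphism is given by sending an Elgot monad $(S,(-)^\dagger)$ to $(S,\rho)$ with $\rho_X=(\mathsf{out}:S^\nu X\to S(X+S^\nu X))^\dagger$, and acting as the identity on the underlying monad morphisms. -/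

import Mathlib

open CategoryTheory CategoryTheory.Limits

universe v u

set_option linter.unusedSectionVars false

noncomputable section

namespace NuAlg

variable {C : Type u} [Category.{v} C] [HasFiniteCoproducts C]

attribute [local simp] coprod.inl_desc coprod.inr_desc coprod.inl_desc_assoc coprod.inr_desc_assoc

/-- The endofunctor `γ ↦ F (X + γ)`. -/
@[simps]
def stepFunctor (F : C ⥤ C) (X : C) : C ⥤ C where
  obj γ := F.obj (X ⨿ γ)
  map f := F.map (coprod.map (𝟙 X) f)
  map_comp f g := by simp [← F.map_comp]

/-- `F` is iteratable if the final coalgebra `νγ. F (X + γ)` exists for every object `X`. -/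
class Iteratable (F : C ⥤ C) : Prop where
  hasTerminal : ∀ X : C, HasTerminal (Endofunctor.Coalgebra (stepFunctor F X))

attribute [instance] Iteratable.hasTerminal

section Functor

variable (F : C ⥤ C) [Iteratable F]

/-- A chosen final coalgebra of `γ ↦ F (X + γ)`. -/
def nuCoalg (X : C) : Endofunctor.Coalgebra (stepFunctor F X) :=
  ⊤_ (Endofunctor.Coalgebra (stepFunctor F X))

/-- The carrier `νγ. F (X + γ)` of the final coalgebra. -/
def nuObj (X : C) : C := (nuCoalg F X).V

/-- The structure map of the final coalgebra. -/
def out (X : C) : nuObj F X ⟶ F.obj (X ⨿ nuObj F X) := (nuCoalg F X).str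

variable {F} in
/-- Coiteration: the unique coalgebra morphism from `(A, f)` to the final coalgebra. -/
def coit {X A : C} (f : A ⟶ F.obj (X ⨿ A)) : A ⟶ nuObj F X :=
  (terminal.from (⟨A, f⟩ : Endofunctor.Coalgebra (stepFunctor F X))).f

variable {F} in
theorem coit_out {X A : C} (f : A ⟶ F.obj (X ⨿ A)) :
    coit f ≫ out F X = f ≫ F.map (coprod.map (𝟙 X) (coit f)) :=
  (terminal.from (⟨A, f⟩ : Endofunctor.Coalgebra (stepFunctor F X))).h.symm

variable {F} in
theorem coit_unique {X A : C} (f : A ⟶ F.obj (X ⨿ A)) (h : A ⟶ nuObj F X)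
    (w : h ≫ out F X = f ≫ F.map (coprod.map (𝟙 X) h)) : h = coit f :=
  congrArg Endofunctor.Coalgebra.Hom.f
    (terminal.hom_ext (⟨h, w.symm⟩ : (⟨A, f⟩ : Endofunctor.Coalgebra (stepFunctor F X)) ⟶
      ⊤_ (Endofunctor.Coalgebra (stepFunctor F X)))
      (terminal.from (⟨A, f⟩ : Endofunctor.Coalgebra (stepFunctor F X))))

/-- The inverse of `out`, which exists by Lambek's lemma. -/
def tuo (X : C) : F.obj (X ⨿ nuObj F X) ⟶ nuObj F X :=
  coit (F.map (coprod.map (𝟙 X) (out F X)))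

@[simp]
theorem out_tuo (X : C) : out F X ≫ tuo F X = 𝟙 _ :=
  Endofunctor.Coalgebra.Terminal.right_inv (A := nuCoalg F X) terminalIsTerminal

@[simp]
theorem tuo_out (X : C) : tuo F X ≫ out F X = 𝟙 _ :=
  Endofunctor.Coalgebra.Terminal.left_inv (A := nuCoalg F X) terminalIsTerminal

@[simp]
theorem out_tuo_assoc {X A : C} (f : nuObj F X ⟶ A) : out F X ≫ tuo F X ≫ f = f := by
  rw [← Category.assoc, out_tuo, Category.id_comp]

@[simp]
theorem tuo_out_assoc {X A : C} (f : F.obj (X ⨿ nuObj F X) ⟶ A) : tuo F X ≫ out F X ≫ f = f := by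
  rw [← Category.assoc, tuo_out, Category.id_comp]

variable {F} in
theorem out_cancel {X A : C} {f g : A ⟶ nuObj F X} (h : f ≫ out F X = g ≫ out F X) : f = g := by
  have := congrArg (· ≫ tuo F X) h
  simpa using this

variable {F} in
/-- Two solutions of the same coiteration equation agree. -/
theorem coind {X A : C} (f : A ⟶ F.obj (X ⨿ A)) {h k : A ⟶ nuObj F X}
    (hh : h ≫ out F X = f ≫ F.map (coprod.map (𝟙 X) h))
    (hk : k ≫ out F X = f ≫ F.map (coprod.map (𝟙 X) k)) : h = k :=
  (coit_unique f h hh).trans (coit_unique f k hk).symm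

/-- The action of `F^ν` on morphisms. -/
def nuMap {X Y : C} (f : X ⟶ Y) : nuObj F X ⟶ nuObj F Y :=
  coit (out F X ≫ F.map (coprod.map f (𝟙 _)))

theorem nuMap_out {X Y : C} (f : X ⟶ Y) :
    nuMap F f ≫ out F Y = out F X ≫ F.map (coprod.map f (nuMap F f)) := by
  simp [nuMap, coit_out, ← F.map_comp]

theorem nuMap_unique {X Y : C} (f : X ⟶ Y) (h : nuObj F X ⟶ nuObj F Y)
    (w : h ≫ out F Y = out F X ≫ F.map (coprod.map f h)) : h = nuMap F f :=
  coit_unique _ _ (by simp [w, ← F.map_comp])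

/-- The functor `F^ν = νγ. F (- + γ)`. -/
@[simps]
def nuFunctor : C ⥤ C where
  obj X := nuObj F X
  map f := nuMap F f
  map_id X := (nuMap_unique F _ _ (by simp)).symm
  map_comp f g := (nuMap_unique F _ _ (by
    simp [nuMap_out, reassoc_of% @nuMap_out, ← F.map_comp])).symm

end Functor

/-- `n`-iteratability (for `n ≥ 1`; the value at `0` is a dummy base case): `F` is `1`-iteratable
if `F^ν` exists, and `(n+1)`-iteratable if moreover `F^ν` is `n`-iteratable. -/
def IsNIteratable : ℕ → (C ⥤ C) → Prop
  | 0, _ => True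
  | n + 1, F => ∃ _ : Iteratable F, IsNIteratable n (nuFunctor F)

/-- `ω`-iteratability. -/
def IsOmegaIteratable (F : C ⥤ C) : Prop := ∀ n : ℕ, IsNIteratable n F

theorem IsOmegaIteratable.iteratable {F : C ⥤ C} (h : IsOmegaIteratable F) : Iteratable F :=
  (h 1).1

theorem IsOmegaIteratable.nu {F : C ⥤ C} [Iteratable F] (h : IsOmegaIteratable F) :
    IsOmegaIteratable (nuFunctor F) :=
  fun n => (h (n + 1)).2

/-- The unit of a monad, typed without the identity functor. -/
def ret (T : Monad C) (X : C) : X ⟶ T.obj X := T.η.app X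

/-- Kleisli lifting `f ↦ f^⋆` of a monad. -/
def kl (T : Monad C) {X Y : C} (f : X ⟶ T.obj Y) : T.obj X ⟶ T.obj Y := T.map f ≫ T.μ.app Y

section Kleisli

variable (T : Monad C)

@[simp]
theorem ret_kl {X Y : C} (f : X ⟶ T.obj Y) : ret T X ≫ kl T f = f := by
  have h := T.η.naturality f
  simp only [Functor.id_map] at h
  rw [kl, ret, ← Category.assoc, ← h]
  exact (Category.assoc _ _ _).trans ((congrArg (f ≫ ·) (T.left_unit Y)).trans (Category.comp_id f))

@[simp]
theorem kl_ret (X : C) : kl T (ret T X) = 𝟙 _ := T.right_unit X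

theorem ret_map {X Y : C} (f : X ⟶ Y) : ret T X ≫ T.map f = f ≫ ret T Y :=
  (T.η.naturality f).symm

theorem kl_kl {X Y Z : C} (f : X ⟶ T.obj Y) (g : Y ⟶ T.obj Z) :
    kl T f ≫ kl T g = kl T (f ≫ kl T g) := by
  simp only [kl, Functor.map_comp, Category.assoc]
  rw [T.assoc, T.mu_naturality_assoc]

theorem map_kl {X Y Z : C} (f : X ⟶ Y) (g : Y ⟶ T.obj Z) :
    T.map f ≫ kl T g = kl T (f ≫ g) := by
  simp [kl]

theorem kl_map {X Y Z : C} (f : X ⟶ T.obj Y) (g : Y ⟶ Z) :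
    kl T f ≫ T.map g = kl T (f ≫ T.map g) := by
  simp only [kl, Functor.map_comp, Category.assoc]
  rw [T.mu_naturality]

theorem map_eq_kl {X Y : C} (f : X ⟶ Y) : T.map f = kl T (f ≫ ret T Y) := by
  rw [← map_kl, kl_ret, Category.comp_id]

variable {T} in
theorem hom_kl {S : Monad C} (α : T ⟶ S) {X Y : C} (f : X ⟶ T.obj Y) :
    kl T f ≫ α.app Y = α.app X ≫ kl S (f ≫ α.app Y) := by
  simp only [kl, Functor.map_comp, Category.assoc, MonadHom.app_μ]
  rw [α.naturality_assoc, α.naturality_assoc]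

variable {T} in
theorem ret_hom {S : Monad C} (α : T ⟶ S) (X : C) : ret T X ≫ α.app X = ret S X := α.app_η X

end Kleisli

section Resumption

variable (T : Monad C) [Iteratable T.toFunctor]

/-- The unit `η^ν = out⁻¹ ∘ η ∘ inl` of `T^ν`. -/
def nuUnit (X : C) : X ⟶ nuObj T.toFunctor X :=
  coprod.inl ≫ ret T (X ⨿ nuObj T.toFunctor X) ≫ tuo T.toFunctor X

/-- Kleisli lifting of `T^ν`, defined by primitive corecursion. -/
def nuBind {X Y : C} (f : X ⟶ nuObj T.toFunctor Y) :
    nuObj T.toFunctor X ⟶ nuObj T.toFunctor Y :=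
  (coprod.inl : _ ⟶ nuObj T.toFunctor X ⨿ nuObj T.toFunctor Y) ≫
    coit (coprod.desc
      (out T.toFunctor X ≫ kl T (coprod.desc
        (f ≫ out T.toFunctor Y ≫ T.map (coprod.map (𝟙 Y) coprod.inr))
        (coprod.inl ≫ coprod.inr ≫ ret T (Y ⨿ (nuObj T.toFunctor X ⨿ nuObj T.toFunctor Y)))))
      (out T.toFunctor Y ≫ T.map (coprod.map (𝟙 Y) coprod.inr)))

/-- A guarded corecursion principle: solutions of an equation of the form
`out ∘ h = [e, η ∘ inr ∘ h]^⋆ ∘ c` are unique. -/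
theorem bind_coind {A X Y : C} (c : A ⟶ T.obj (X ⨿ A))
    (e : X ⟶ T.obj (Y ⨿ nuObj T.toFunctor Y)) {h k : A ⟶ nuObj T.toFunctor Y}
    (hh : h ≫ out T.toFunctor Y = c ≫ kl T (coprod.desc e (h ≫ coprod.inr ≫ ret T (Y ⨿ nuObj T.toFunctor Y))))
    (hk : k ≫ out T.toFunctor Y = c ≫ kl T (coprod.desc e (k ≫ coprod.inr ≫ ret T (Y ⨿ nuObj T.toFunctor Y)))) :
    h = k := by
  let d : A ⨿ nuObj T.toFunctor Y ⟶ T.obj (Y ⨿ (A ⨿ nuObj T.toFunctor Y)) := coprod.desc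
      (c ≫ kl T (coprod.desc (e ≫ T.map (coprod.map (𝟙 Y) coprod.inr))
        (coprod.inl ≫ coprod.inr ≫ ret T (Y ⨿ (A ⨿ nuObj T.toFunctor Y)))))
      (out T.toFunctor Y ≫ T.map (coprod.map (𝟙 Y) coprod.inr))
  have key : ∀ l : A ⟶ nuObj T.toFunctor Y,
      l ≫ out T.toFunctor Y = c ≫ kl T (coprod.desc e (l ≫ coprod.inr ≫ ret T (Y ⨿ nuObj T.toFunctor Y))) →
      coprod.desc l (𝟙 _) = coit d := by
    intro l hl
    apply coit_unique
    apply coprod.hom_ext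
    · simp only [d, coprod.inl_desc_assoc, hl, Category.assoc, kl_map]
      congr 2
      apply coprod.hom_ext
      · simp [← Functor.map_comp]
      · simp [ret_map]
    · simp [d, ← Functor.map_comp]
  have := (key h hh).trans (key k hk).symm
  simpa using congrArg (coprod.inl ≫ ·) this

theorem nuUnit_out (X : C) : nuUnit T X ≫ out T.toFunctor X = coprod.inl ≫ ret T (X ⨿ nuObj T.toFunctor X) := by
  simp [nuUnit]

/-- The characteristic equation `out ∘ f^⋆ = [out ∘ f, η ∘ inr ∘ f^⋆]^⋆ ∘ out`. -/
theorem nuBind_out {X Y : C} (f : X ⟶ nuObj T.toFunctor Y) :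
    nuBind T f ≫ out T.toFunctor Y = out T.toFunctor X ≫
      kl T (coprod.desc (f ≫ out T.toFunctor Y) (nuBind T f ≫ coprod.inr ≫ ret T (Y ⨿ nuObj T.toFunctor Y))) := by
  have hr : (coprod.inr : _ ⟶ nuObj T.toFunctor X ⨿ nuObj T.toFunctor Y) ≫
      coit (coprod.desc
        (out T.toFunctor X ≫ kl T (coprod.desc
          (f ≫ out T.toFunctor Y ≫ T.map (coprod.map (𝟙 Y) coprod.inr))
          (coprod.inl ≫ coprod.inr ≫ ret T (Y ⨿ (nuObj T.toFunctor X ⨿ nuObj T.toFunctor Y)))))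
        (out T.toFunctor Y ≫ T.map (coprod.map (𝟙 Y) coprod.inr))) = 𝟙 _ := by
    apply coind (out T.toFunctor Y)
    · simp [coit_out, ← Functor.map_comp]
    · simp
  conv_lhs => rw [nuBind, Category.assoc, coit_out, coprod.inl_desc_assoc, Category.assoc, kl_map]
  congr 2
  apply coprod.hom_ext
  · simp [← Functor.map_comp, hr]
  · simp [nuBind, ret_map]

theorem nuBind_unique {X Y : C} (f : X ⟶ nuObj T.toFunctor Y)
    (h : nuObj T.toFunctor X ⟶ nuObj T.toFunctor Y)
    (w : h ≫ out T.toFunctor Y = out T.toFunctor X ≫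
      kl T (coprod.desc (f ≫ out T.toFunctor Y) (h ≫ coprod.inr ≫ ret T (Y ⨿ nuObj T.toFunctor Y)))) :
    h = nuBind T f :=
  bind_coind T _ _ w (nuBind_out T f)

@[simp]
theorem nuUnit_bind {X Y : C} (f : X ⟶ nuObj T.toFunctor Y) : nuUnit T X ≫ nuBind T f = f := by
  apply out_cancel
  simp [nuBind_out, reassoc_of% @nuUnit_out]

theorem nuMap_eq {X Y : C} (f : X ⟶ Y) : nuMap T.toFunctor f = nuBind T (f ≫ nuUnit T Y) := by
  apply nuBind_unique
  rw [nuMap_out, map_eq_kl]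
  congr 2
  apply coprod.hom_ext <;> simp [nuUnit_out]

theorem nuBind_unit (X : C) : nuBind T (nuUnit T X) = 𝟙 _ := by
  have := nuMap_eq T (𝟙 X)
  rw [Category.id_comp] at this
  rw [← this]
  exact (nuFunctor T.toFunctor).map_id X

theorem nuBind_bind {X Y Z : C} (f : X ⟶ nuObj T.toFunctor Y) (g : Y ⟶ nuObj T.toFunctor Z) :
    nuBind T f ≫ nuBind T g = nuBind T (f ≫ nuBind T g) := by
  apply nuBind_unique
  rw [Category.assoc, nuBind_out, reassoc_of% @nuBind_out, kl_kl]
  congr 2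
  apply coprod.hom_ext <;> simp [nuBind_out]

/-- The coinductive resumption transform `T^ν` as a monad. -/
def nuMonad : Monad C where
  toFunctor := nuFunctor T.toFunctor
  η := { app := fun X => nuUnit T X
         naturality := fun X Y f => by
          change f ≫ nuUnit T Y = nuUnit T X ≫ nuMap T.toFunctor f
          simp [nuMap_eq] }
  μ := { app := fun X => nuBind T (𝟙 (nuObj T.toFunctor X))
         naturality := fun X Y f => by
          change nuMap T.toFunctor (nuMap T.toFunctor f) ≫ nuBind T (𝟙 _) =
            nuBind T (𝟙 _) ≫ nuMap T.toFunctor f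
          simp [nuMap_eq, nuBind_bind] }
  assoc X := by
    change nuMap T.toFunctor (nuBind T (𝟙 _)) ≫ nuBind T (𝟙 _) = nuBind T (𝟙 _) ≫ nuBind T (𝟙 _)
    simp [nuMap_eq, nuBind_bind]
  left_unit X := nuUnit_bind T _
  right_unit X := by
    change nuMap T.toFunctor (nuUnit T X) ≫ nuBind T (𝟙 _) = 𝟙 _
    simp [nuMap_eq, nuBind_bind, nuBind_unit]

theorem kl_nuMonad {X Y : C} (f : X ⟶ nuObj T.toFunctor Y) :
    kl (nuMonad T) (X := X) (Y := Y) f = nuBind T f := by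
  change nuMap T.toFunctor f ≫ nuBind T (𝟙 _) = _
  simp [nuMap_eq, nuBind_bind]

/-- The delay transformation `▷ = out⁻¹ ∘ η ∘ inr`. -/
def delay (X : C) : nuObj T.toFunctor X ⟶ nuObj T.toFunctor X :=
  coprod.inr ≫ ret T (X ⨿ nuObj T.toFunctor X) ≫ tuo T.toFunctor X

/-- The components `out⁻¹ ∘ T inl : T X ⟶ T^ν X` of the unit of `(-)^ν`. -/
def metaUnit (X : C) : T.obj X ⟶ nuObj T.toFunctor X :=
  T.map coprod.inl ≫ tuo T.toFunctor X

/-- The components `coit (T [id, inr ∘ out⁻¹] ∘ out ∘ out) : T^νν X ⟶ T^ν X` of the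
multiplication of `(-)^ν`. -/
def metaMult [Iteratable (nuMonad T).toFunctor] (X : C) :
    nuObj (nuMonad T).toFunctor X ⟶ nuObj T.toFunctor X :=
  coit (out (nuMonad T).toFunctor X ≫
    out T.toFunctor (X ⨿ nuObj (nuMonad T).toFunctor X) ≫
    T.map (coprod.desc (𝟙 _) (tuo (nuMonad T).toFunctor X ≫ coprod.inr)))

end Resumption

section Hom

variable {T S : Monad C} [Iteratable T.toFunctor] [Iteratable S.toFunctor] (α : T ⟶ S)

/-- The components `coit (α ∘ out)` of `α^ν : T^ν ⟶ S^ν`. -/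
def nuHomApp (X : C) : nuObj T.toFunctor X ⟶ nuObj S.toFunctor X :=
  coit (out T.toFunctor X ≫ α.app _)

theorem nuHomApp_out (X : C) : nuHomApp α X ≫ out S.toFunctor X =
    out T.toFunctor X ≫ α.app _ ≫ S.map (coprod.map (𝟙 X) (nuHomApp α X)) := by
  simp [nuHomApp, coit_out]

theorem nuUnit_homApp (X : C) : nuUnit T X ≫ nuHomApp α X = nuUnit S X := by
  apply out_cancel
  simp [nuHomApp_out, nuUnit_out, reassoc_of% @nuUnit_out, reassoc_of% @ret_hom, ret_map]

theorem nuBind_homApp {X Y : C} (f : X ⟶ nuObj T.toFunctor Y) :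
    nuBind T f ≫ nuHomApp α Y = nuHomApp α X ≫ nuBind S (f ≫ nuHomApp α Y) := by
  apply bind_coind S (out T.toFunctor X ≫ α.app _) (f ≫ nuHomApp α Y ≫ out S.toFunctor Y)
  · simp only [Category.assoc, nuHomApp_out, reassoc_of% @nuBind_out, reassoc_of% @hom_kl, kl_map]
    congr 3
    apply coprod.hom_ext
    · simp
    · simp [reassoc_of% @ret_hom, ret_map]
  · simp only [Category.assoc, reassoc_of% @nuHomApp_out, nuBind_out, map_kl]
    congr 3
    apply coprod.hom_ext <;> simp

/-- The monad morphism `α^ν : T^ν ⟶ S^ν`. -/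
def nuHom : nuMonad T ⟶ nuMonad S where
  app X := nuHomApp α X
  naturality X Y f := by
    change nuMap _ f ≫ _ = _ ≫ nuMap _ f
    simp only [nuMap_eq, nuBind_homApp, Category.assoc, nuUnit_homApp]
  app_η X := nuUnit_homApp α X
  app_μ X := by
    change nuBind T (𝟙 _) ≫ nuHomApp α X =
      (nuMap _ (nuHomApp α X) ≫ nuHomApp α _) ≫ nuBind S (𝟙 _)
    simp only [nuMap_eq, nuBind_homApp, Category.assoc, nuUnit_homApp, nuBind_bind, nuUnit_bind,
      Category.id_comp, Category.comp_id]

end Hom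

variable (C) in
/-- The property of a monad that its underlying functor is `ω`-iteratable. -/
def isOmegaIteratable : ObjectProperty (Monad C) := fun T => IsOmegaIteratable T.toFunctor

variable (C) in
/-- The category of `ω`-iteratable monads over `C` and all monad morphisms. -/
abbrev OmegaMonad := (isOmegaIteratable C).FullSubcategory

instance (S : OmegaMonad C) : Iteratable S.obj.toFunctor := S.property.iteratable

/-- `S^ν` as an `ω`-iteratable monad. -/
def nuOmega (S : OmegaMonad C) : OmegaMonad C := ⟨nuMonad S.obj, S.property.nu⟩

instance (S : OmegaMonad C) : Iteratable (nuMonad S.obj).toFunctor := (nuOmega S).property.iteratable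

variable (C) in
/-- The endofunctor `S ↦ S^ν`, `α ↦ α^ν` of the category of `ω`-iteratable monads. -/
@[simps obj]
def nu : OmegaMonad C ⥤ OmegaMonad C where
  obj := nuOmega
  map α := ObjectProperty.homMk (nuHom α.hom)
  map_id S := by
    ext X
    refine (coit_unique _ _ ?_).symm
    change 𝟙 (nuObj _ X) ≫ out _ X = (out _ X ≫ 𝟙 _) ≫ S.obj.map (coprod.map (𝟙 X) (𝟙 _))
    simp
  map_comp {S T U} α β := by
    ext X
    refine (coit_unique _ _ ?_).symm
    change (nuHomApp α.hom X ≫ nuHomApp β.hom X) ≫ out U.obj.toFunctor X =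
      (out S.obj.toFunctor X ≫ α.hom.app _ ≫ β.hom.app _) ≫
        U.obj.map (coprod.map (𝟙 X) (nuHomApp α.hom X ≫ nuHomApp β.hom X))
    simp only [Category.assoc, nuHomApp_out, reassoc_of% @nuHomApp_out]
    rw [β.hom.naturality_assoc, ← Functor.map_comp]
    simp

/-- The monad with underlying endofunctor `S ↦ S^ν` and the given unit and multiplication. -/
abbrev nuMonadOf (η : 𝟭 (OmegaMonad C) ⟶ nu C) (μ : nu C ⋙ nu C ⟶ nu C)
    (assoc : ∀ S, (nu C).map (μ.app S) ≫ μ.app S = μ.app ((nu C).obj S) ≫ μ.app S)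
    (left_unit : ∀ S, η.app ((nu C).obj S) ≫ μ.app S = 𝟙 ((nu C).obj S))
    (right_unit : ∀ S, (nu C).map (η.app S) ≫ μ.app S = 𝟙 ((nu C).obj S)) :
    Monad (OmegaMonad C) where
  toFunctor := nu C
  η := η
  μ := μ
  assoc := assoc
  left_unit := left_unit
  right_unit := right_unit

/-- Delay cancellation `ρ ∘ ▷ = ρ` for a morphism `ρ : S^ν ⟶ S`. -/
def CancelsDelay {S : OmegaMonad C} (ρ : (nu C).obj S ⟶ S) : Prop :=
  ∀ X : C, delay S.obj X ≫ ρ.hom.app X = ρ.hom.app X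

/-- A (complete) Elgot structure on a monad `T`: a total iteration operator `f ↦ f†` subject to
the fixpoint, naturality, codiagonal and uniformity laws. -/
@[ext]
structure ElgotStructure (T : Monad C) where
  /-- the iteration operator -/
  iter : ∀ {X Y : C}, (X ⟶ T.obj (Y ⨿ X)) → (X ⟶ T.obj Y)
  fixpoint : ∀ {X Y : C} (f : X ⟶ T.obj (Y ⨿ X)),
    f ≫ kl T (coprod.desc (ret T Y) (iter f)) = iter f
  naturality : ∀ {X Y Z : C} (f : X ⟶ T.obj (Y ⨿ X)) (g : Y ⟶ T.obj Z),
    iter f ≫ kl T g =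
      iter (f ≫ kl T (coprod.desc (g ≫ T.map coprod.inl) (coprod.inr ≫ ret T (Z ⨿ X))))
  codiagonal : ∀ {X Y : C} (f : X ⟶ T.obj ((Y ⨿ X) ⨿ X)),
    iter (f ≫ T.map (coprod.desc (𝟙 (Y ⨿ X)) coprod.inr)) = iter (iter f)
  uniformity : ∀ {X Y Z : C} (f : X ⟶ T.obj (Y ⨿ X)) (g : Z ⟶ T.obj (Y ⨿ Z)) (h : Z ⟶ X),
    h ≫ f = g ≫ T.map (coprod.map (𝟙 Y) h) → h ≫ iter f = iter g

variable (C) in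
/-- An `ω`-iteratable Elgot monad over `C`. -/
structure OmegaElgot where
  /-- the underlying `ω`-iteratable monad -/
  toOmega : OmegaMonad C
  /-- the iteration operator, with its laws -/
  elgot : ElgotStructure toOmega.obj

namespace OmegaElgot

/-- A morphism of Elgot monads is a monad morphism that preserves iteration. -/
@[ext]
structure Hom (E E' : OmegaElgot C) where
  /-- the underlying morphism of monads -/
  hom : E.toOmega ⟶ E'.toOmega
  preserves : ∀ {X Y : C} (f : X ⟶ E.toOmega.obj.obj (Y ⨿ X)),
    E.elgot.iter f ≫ hom.hom.app Y = E'.elgot.iter (f ≫ hom.hom.app (Y ⨿ X))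

instance : Category (OmegaElgot C) where
  Hom := Hom
  id E := ⟨𝟙 _, fun f => by
    change E.elgot.iter f ≫ 𝟙 _ = E.elgot.iter (f ≫ 𝟙 _)
    simp⟩
  comp {E E' E''} a b := ⟨a.hom ≫ b.hom, fun {X Y} f => by
    change E.elgot.iter f ≫ a.hom.hom.app Y ≫ b.hom.hom.app Y =
      E''.elgot.iter (f ≫ a.hom.hom.app _ ≫ b.hom.hom.app _)
    rw [← Category.assoc, a.preserves, b.preserves, Category.assoc]⟩

variable (C) in
/-- The functor that forgets the iteration operator. -/
@[simps]
def forget : OmegaElgot C ⥤ OmegaMonad C where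
  obj E := E.toOmega
  map a := Hom.hom a

end OmegaElgot

end NuAlg

end

/-!
The proof is a calculation with two uniqueness principles and the four iteration laws.

*The monad.* A morphism into `T^ν Y` is determined by a delay-guarded equation
`h = [e, ▷ ∘ h]^* ∘ c` (`delay_coind`). The multiplication `m : T^νν ⟶ T^ν` is itself the solution
of such an equation, `m = [η^ν, ▷ ∘ m]^* ∘ out` (`metaMult_eq`). That `m` preserves Kleisli
liftings, that it is natural in `T`, that it is associative and that the right unit law holds are
therefore all proved in the same way: both sides solve one guarded equation, because `▷` commutes
with Kleisli liftings, with `α^ν` and with `m`. The left unit law is a single unfolding of `m`.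

*From Elgot monads to algebras.* Put `ρ = out†`. Since `coit f` is a coalgebra morphism,
uniformity gives `ρ ∘ coit f = f†` (`coit_iterOut`). The unit law and delay cancellation follow
from the fixpoint law. That `ρ` preserves Kleisli liftings amounts to merging a loop followed by
another loop into a single loop on a coproduct, a Bekić identity (`iter_comp_iter`). For the
multiplication, `out† ∘ out` is an iterate by uniformity, so that `ρ ∘ ρ^ν` is a double iterate,
and the codiagonal law identifies it with `ρ ∘ m` (`metaMult_iterOut`).

*From algebras to Elgot monads.* Put `f† = ρ ∘ coit f`. Uniformity and naturality reflect the
corresponding properties of `coit`, and the fixpoint law uses `out⁻¹ = [η^ν, ▷]^* ∘ (unit of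
(-)^ν)` (`tuo_eq`) together with delay cancellation. The codiagonal law is associativity of the
algebra, because `m` flattens nested coiterations (`coit_coit_metaMult`).

The two constructions are inverse to each other, by `coit_iterOut` in one direction and because
`coit out` is the identity in the other. Both leave the
underlying monad morphisms alone, so they form an isomorphism of categories, not merely an
equivalence.
-/

noncomputable section

namespace NuAlg

variable {C : Type u} [Category.{v} C] [HasFiniteCoproducts C]

attribute [local simp] coprod.inl_desc coprod.inr_desc coprod.inl_desc_assoc coprod.inr_desc_assoc

/-! ### Kleisli calculus and guarded corecursion -/

section Kleisli

variable (T : Monad C)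

theorem ret_kl_assoc {X Y Z : C} (f : X ⟶ T.obj Y) (g : T.obj Y ⟶ Z) :
    ret T X ≫ kl T f ≫ g = f ≫ g := by
  rw [← Category.assoc, ret_kl]

variable {T} in
/-- A family of morphisms that respects units and Kleisli liftings is a monad morphism. -/
def homOfKl {S : Monad C} (φ : ∀ X : C, T.obj X ⟶ S.obj X)
    (hret : ∀ X : C, ret T X ≫ φ X = ret S X)
    (hkl : ∀ {X Y : C} (f : X ⟶ T.obj Y), kl T f ≫ φ Y = φ X ≫ kl S (f ≫ φ Y)) : T ⟶ S where
  app := φ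
  naturality X Y f := by
    rw [map_eq_kl, hkl, map_eq_kl, Category.assoc, hret]
  app_η := hret
  app_μ X := by
    have hmap : T.map (φ X) ≫ φ _ = φ _ ≫ S.map (φ X) := by
      rw [map_eq_kl, hkl, map_eq_kl, Category.assoc, hret]
    have h := hkl (𝟙 (T.obj X))
    simp only [Category.id_comp, kl, T.map_id] at h
    rw [h, hmap, Category.assoc]

end Kleisli

attribute [local simp] ret_kl_assoc

section Guarded

variable (T : Monad C) [Iteratable T.toFunctor]

theorem delay_out (X : C) :
    delay T X ≫ out T.toFunctor X = coprod.inr ≫ ret T (X ⨿ nuObj T.toFunctor X) := by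
  simp [delay]

theorem metaUnit_out (X : C) : metaUnit T X ≫ out T.toFunctor X = T.map coprod.inl := by
  simp [metaUnit]

theorem nuMap_nuBind {X Y Z : C} (f : X ⟶ Y) (g : Y ⟶ nuObj T.toFunctor Z) :
    nuMap T.toFunctor f ≫ nuBind T g = nuBind T (f ≫ g) := by
  simp [nuMap_eq, nuBind_bind]

theorem delay_nuBind {X Y : C} (f : X ⟶ nuObj T.toFunctor Y) :
    delay T X ≫ nuBind T f = nuBind T f ≫ delay T Y := by
  apply out_cancel
  simp [nuBind_out, delay_out, reassoc_of% @delay_out]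

theorem metaUnit_nuBind {X Y : C} (f : X ⟶ nuObj T.toFunctor Y) :
    metaUnit T X ≫ nuBind T f = kl T (f ≫ out T.toFunctor Y) ≫ tuo T.toFunctor Y := by
  apply out_cancel
  simp [nuBind_out, reassoc_of% @metaUnit_out, map_kl]

/-- The inverse of `out` sends an effectful step to that effect followed by either a return or a
delayed continuation. -/
theorem tuo_eq (X : C) :
    tuo T.toFunctor X = metaUnit T _ ≫ nuBind T (coprod.desc (nuUnit T X) (delay T X)) := by
  have : coprod.desc (nuUnit T X) (delay T X) ≫ out T.toFunctor X = ret T _ := by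
    apply coprod.hom_ext <;> simp [nuUnit_out, delay_out]
  rw [metaUnit_nuBind, this, kl_ret, Category.id_comp]

/-- Delay-guarded equations `h = [e, ▷ ∘ h]^* ∘ c` over `T^ν` have at most one solution: the
extension `[e, ▷ ∘ h]^*` solves an instance of `bind_coind`, so it is unique, and it determines
`h`. -/
theorem delay_coind {A X Y : C} (c : A ⟶ nuObj T.toFunctor (X ⨿ A)) (e : X ⟶ nuObj T.toFunctor Y)
    {h k : A ⟶ nuObj T.toFunctor Y}
    (hh : h = c ≫ nuBind T (coprod.desc e (h ≫ delay T Y)))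
    (hk : k = c ≫ nuBind T (coprod.desc e (k ≫ delay T Y))) : h = k := by
  have key : ∀ l : A ⟶ nuObj T.toFunctor Y, l = c ≫ nuBind T (coprod.desc e (l ≫ delay T Y)) →
      nuBind T (coprod.desc e (l ≫ delay T Y)) ≫ out T.toFunctor Y =
        (out T.toFunctor (X ⨿ A) ≫ T.map (coprod.desc (coprod.map (𝟙 X) c) coprod.inr)) ≫
        kl T (coprod.desc (e ≫ out T.toFunctor Y)
          (nuBind T (coprod.desc e (l ≫ delay T Y)) ≫ coprod.inr ≫
            ret T (Y ⨿ nuObj T.toFunctor Y))) := by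
    intro l hl
    rw [nuBind_out, Category.assoc, map_kl]
    congr 2
    apply coprod.hom_ext
    · apply coprod.hom_ext
      · simp
      · simp only [coprod.inl_desc, coprod.inr_desc_assoc, coprod.inl_desc_assoc, Category.assoc,
          delay_out, coprod.inr_map_assoc, coprod.inr_desc]
        rw [← reassoc_of% hl]
    · simp
  rw [hh, hk, bind_coind T _ _ (key h hh) (key k hk)]

end Guarded

/-! ### The unit and the multiplication -/

section MetaUnit

variable (T : Monad C) [Iteratable T.toFunctor]

theorem ret_metaUnit (X : C) : ret T X ≫ metaUnit T X = nuUnit T X := by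
  apply out_cancel
  simp [metaUnit_out, nuUnit_out, ret_map]

theorem kl_metaUnit {X Y : C} (f : X ⟶ T.obj Y) :
    kl T f ≫ metaUnit T Y = metaUnit T X ≫ nuBind T (f ≫ metaUnit T Y) := by
  rw [metaUnit_nuBind, Category.assoc, metaUnit_out, ← kl_map, metaUnit, Category.assoc]

theorem metaUnit_homApp {T S : Monad C} [Iteratable T.toFunctor] [Iteratable S.toFunctor]
    (α : T ⟶ S) (X : C) : metaUnit T X ≫ nuHomApp α X = α.app X ≫ metaUnit S X := by
  apply out_cancel
  simp [metaUnit_out, nuHomApp_out, reassoc_of% @metaUnit_out, ← Functor.map_comp]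

theorem delay_homApp {T S : Monad C} [Iteratable T.toFunctor] [Iteratable S.toFunctor]
    (α : T ⟶ S) (X : C) : delay T X ≫ nuHomApp α X = nuHomApp α X ≫ delay S X := by
  apply out_cancel
  simp [delay_out, nuHomApp_out, reassoc_of% @delay_out, reassoc_of% @ret_hom, ret_map]

/-- The unit `T ⟶ T^ν` of `(-)^ν` as a monad morphism. -/
def metaUnitHom : T ⟶ nuMonad T :=
  homOfKl (S := nuMonad T) (metaUnit T) (ret_metaUnit T) fun f =>
    (kl_metaUnit T f).trans (congrArg (metaUnit T _ ≫ ·) (kl_nuMonad T _).symm)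

end MetaUnit

section MetaMult

variable (T : Monad C) [Iteratable T.toFunctor] [Iteratable (nuMonad T).toFunctor]

/-- The structure map `T^νν X ⟶ T^ν (X + T^νν X)`, typed by the carrier of `T^ν`. -/
def outNu (X : C) : nuObj (nuMonad T).toFunctor X ⟶
    nuObj T.toFunctor (X ⨿ nuObj (nuMonad T).toFunctor X) :=
  out (nuMonad T).toFunctor X

/-- The inverse of `outNu`. -/
def tuoNu (X : C) : nuObj T.toFunctor (X ⨿ nuObj (nuMonad T).toFunctor X) ⟶
    nuObj (nuMonad T).toFunctor X :=
  tuo (nuMonad T).toFunctor X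

theorem outNu_tuoNu (X : C) : outNu T X ≫ tuoNu T X = 𝟙 _ := out_tuo (nuMonad T).toFunctor X

theorem tuoNu_outNu (X : C) : tuoNu T X ≫ outNu T X = 𝟙 _ := tuo_out (nuMonad T).toFunctor X

theorem nuUnit_outNu (X : C) :
    nuUnit (nuMonad T) X ≫ outNu T X = coprod.inl ≫ nuUnit T _ :=
  nuUnit_out (nuMonad T) X

theorem delay_outNu (X : C) :
    delay (nuMonad T) X ≫ outNu T X = coprod.inr ≫ nuUnit T _ :=
  delay_out (nuMonad T) X

theorem metaUnit_outNu (X : C) :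
    metaUnit (nuMonad T) X ≫ outNu T X = nuMap T.toFunctor coprod.inl :=
  metaUnit_out (nuMonad T) X

theorem nuBind_outNu {X Y : C} (f : X ⟶ nuObj (nuMonad T).toFunctor Y) :
    nuBind (nuMonad T) f ≫ outNu T Y = outNu T X ≫ nuBind T (coprod.desc (f ≫ outNu T Y)
      (nuBind (nuMonad T) f ≫ coprod.inr ≫ nuUnit T _)) :=
  (nuBind_out (nuMonad T) f).trans (congrArg (outNu T X ≫ ·) (kl_nuMonad T _))

theorem coit_outNu {X A : C} (f : A ⟶ nuObj T.toFunctor (X ⨿ A)) :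
    coit (F := (nuMonad T).toFunctor) f ≫ outNu T X =
      f ≫ nuMap T.toFunctor (coprod.map (𝟙 X) (coit (F := (nuMonad T).toFunctor) f)) :=
  coit_out (F := (nuMonad T).toFunctor) f

theorem metaMult_out (X : C) : metaMult T X ≫ out T.toFunctor X = outNu T X ≫
    out T.toFunctor _ ≫ T.map (coprod.desc (coprod.map (𝟙 X) (metaMult T X))
      (tuoNu T X ≫ metaMult T X ≫ coprod.inr)) := by
  rw [metaMult, coit_out, ← metaMult]
  change (outNu T X ≫ _ ≫ T.map (coprod.desc (𝟙 _) (tuoNu T X ≫ coprod.inr))) ≫ _ = _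
  simp only [Category.assoc, ← Functor.map_comp]
  congr 3
  apply coprod.hom_ext <;> simp

/-- The multiplication runs the outer resumption, with a delay at each of its steps. -/
theorem metaMult_eq (X : C) : metaMult T X = outNu T X ≫
    nuBind T (coprod.desc (nuUnit T X) (metaMult T X ≫ delay T X)) := by
  have h : tuoNu T X ≫ metaMult T X =
      nuBind T (coprod.desc (nuUnit T X) (metaMult T X ≫ delay T X)) := by
    apply nuBind_unique
    rw [Category.assoc, metaMult_out, reassoc_of% @tuoNu_outNu, map_eq_kl]
    congr 2
    apply coprod.hom_ext
    · apply coprod.hom_ext <;> simp [nuUnit_out, delay_out]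
    · simp
  rw [← h, reassoc_of% @outNu_tuoNu]

theorem nuUnit_metaMult (X : C) : nuUnit (nuMonad T) X ≫ metaMult T X = nuUnit T X := by
  rw [metaMult_eq, reassoc_of% @nuUnit_outNu]
  simp

theorem delay_metaMult (X : C) :
    delay (nuMonad T) X ≫ metaMult T X = metaMult T X ≫ delay T X := by
  conv_lhs => rw [metaMult_eq, reassoc_of% @delay_outNu]
  simp

theorem nuBind_metaMult {X Y : C} (f : X ⟶ nuObj (nuMonad T).toFunctor Y) :
    nuBind (nuMonad T) f ≫ metaMult T Y = metaMult T X ≫ nuBind T (f ≫ metaMult T Y) := by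
  apply delay_coind T (outNu T X) (f ≫ metaMult T Y)
  · conv_lhs => rw [metaMult_eq, reassoc_of% @nuBind_outNu, nuBind_bind]
    congr 2
    apply coprod.hom_ext
    · simp [← metaMult_eq]
    · simp
  · conv_lhs => rw [metaMult_eq, Category.assoc, nuBind_bind]
    congr 2
    apply coprod.hom_ext
    · simp
    · simp [delay_nuBind]

/-- The multiplication `T^νν ⟶ T^ν` of `(-)^ν` as a monad morphism. -/
def metaMultHom : nuMonad (nuMonad T) ⟶ nuMonad T :=
  homOfKl (T := nuMonad (nuMonad T)) (S := nuMonad T) (metaMult T) (nuUnit_metaMult T) fun f =>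
    (congrArg (· ≫ metaMult T _) (kl_nuMonad (nuMonad T) f)).trans
      ((nuBind_metaMult T f).trans (congrArg (metaMult T _ ≫ ·) (kl_nuMonad T _).symm))

theorem metaMult_homApp {T S : Monad C} [Iteratable T.toFunctor] [Iteratable S.toFunctor]
    [Iteratable (nuMonad T).toFunctor] [Iteratable (nuMonad S).toFunctor] (α : T ⟶ S) (X : C) :
    nuHomApp (nuHom α) X ≫ metaMult S X = metaMult T X ≫ nuHomApp α X := by
  have hout : nuHomApp (nuHom α) X ≫ outNu S X = outNu T X ≫ nuHomApp α _ ≫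
      nuMap S.toFunctor (coprod.map (𝟙 X) (nuHomApp (nuHom α) X)) := nuHomApp_out (nuHom α) X
  apply delay_coind S (outNu T X ≫ nuHomApp α _) (nuUnit S X)
  · conv_lhs => rw [metaMult_eq, reassoc_of% hout, nuMap_nuBind]
    simp
  · conv_lhs => rw [metaMult_eq, Category.assoc, nuBind_homApp]
    rw [Category.assoc]
    congr 3
    apply coprod.hom_ext <;> simp [nuUnit_homApp, delay_homApp]

theorem metaMult_assoc [Iteratable (nuMonad (nuMonad T)).toFunctor] (X : C) :
    nuHomApp (metaMultHom T) X ≫ metaMult T X = metaMult (nuMonad T) X ≫ metaMult T X := by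
  have hout : nuHomApp (metaMultHom T) X ≫ outNu T X = outNu (nuMonad T) X ≫ metaMult T _ ≫
      nuMap T.toFunctor (coprod.map (𝟙 X) (nuHomApp (metaMultHom T) X)) :=
    nuHomApp_out (metaMultHom T) X
  apply delay_coind T (outNu (nuMonad T) X ≫ metaMult T _) (nuUnit T X)
  · conv_lhs => rw [metaMult_eq, reassoc_of% hout, nuMap_nuBind]
    simp
  · conv_lhs => rw [metaMult_eq (nuMonad T), Category.assoc, nuBind_metaMult]
    rw [Category.assoc]
    congr 3
    apply coprod.hom_ext <;> simp [nuUnit_metaMult, delay_metaMult]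

theorem metaUnit_metaMult (X : C) : metaUnit (nuMonad T) X ≫ metaMult T X = 𝟙 _ := by
  rw [metaMult_eq, reassoc_of% @metaUnit_outNu]
  exact (nuMap_nuBind T _ _).trans (by rw [coprod.inl_desc, nuBind_unit]; rfl)

theorem metaUnitHom_metaMult (X : C) : nuHomApp (metaUnitHom T) X ≫ metaMult T X = 𝟙 _ := by
  have hout : nuHomApp (metaUnitHom T) X ≫ outNu T X = out T.toFunctor X ≫ metaUnit T _ ≫
      nuMap T.toFunctor (coprod.map (𝟙 X) (nuHomApp (metaUnitHom T) X)) :=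
    nuHomApp_out (metaUnitHom T) X
  apply delay_coind T (out T.toFunctor X ≫ metaUnit T _) (nuUnit T X)
  · conv_lhs => rw [metaMult_eq, reassoc_of% hout, nuMap_nuBind]
    simp
  · simp [← tuo_eq]

end MetaMult

/-! ### From iteration operators to algebras -/

section Elgot

variable {T : Monad C} (E : ElgotStructure T)

/-- A loop `a`, followed by `b` and then by a loop `c`, is a single loop on the coproduct of the
two state objects. The codiagonal law splits the joint loop into an inner loop, which iterates `c`,
and an outer one, which iterates `a`. -/
theorem iter_comp_iter {A B X Y : C} (a : A ⟶ T.obj (X ⨿ A)) (b : X ⟶ T.obj (Y ⨿ B))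
    (c : B ⟶ T.obj (Y ⨿ B)) :
    E.iter a ≫ kl T (b ≫ kl T (coprod.desc (ret T Y) (E.iter c))) =
      (coprod.inl : A ⟶ A ⨿ B) ≫ E.iter (coprod.desc
        (a ≫ kl T (coprod.desc (b ≫ T.map (coprod.map (𝟙 Y) coprod.inr))
          (coprod.inl ≫ coprod.inr ≫ ret T (Y ⨿ (A ⨿ B)))))
        (c ≫ T.map (coprod.map (𝟙 Y) coprod.inr))) := by
  set d : A ⨿ B ⟶ T.obj (Y ⨿ (A ⨿ B)) := coprod.desc
        (a ≫ kl T (coprod.desc (b ≫ T.map (coprod.map (𝟙 Y) coprod.inr))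
          (coprod.inl ≫ coprod.inr ≫ ret T (Y ⨿ (A ⨿ B)))))
        (c ≫ T.map (coprod.map (𝟙 Y) coprod.inr)) with hd
  -- states in `A` are handed to the outer loop, states in `B` to the inner one
  let split : Y ⨿ (A ⨿ B) ⟶ (Y ⨿ (A ⨿ B)) ⨿ (A ⨿ B) :=
    coprod.desc (coprod.inl ≫ coprod.inl)
      (coprod.desc (coprod.inl ≫ coprod.inr ≫ coprod.inl) (coprod.inr ≫ coprod.inr))
  have hsplit : split ≫ coprod.desc (𝟙 _) coprod.inr = 𝟙 _ := by
    apply coprod.hom_ext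
    · simp [split]
    · apply coprod.hom_ext <;> simp [split]
  have hdw : d = (d ≫ T.map split) ≫ T.map (coprod.desc (𝟙 _) coprod.inr) := by
    rw [Category.assoc, ← T.map_comp, hsplit, T.map_id, Category.comp_id]
  have hinr : coprod.inr ≫ E.iter (d ≫ T.map split) = E.iter c ≫ T.map coprod.inl := by
    rw [map_eq_kl T coprod.inl, E.naturality]
    apply E.uniformity
    rw [hd, coprod.inr_desc_assoc, Category.assoc, Category.assoc, kl_map, ← T.map_comp, map_eq_kl]
    congr 2
    apply coprod.hom_ext
    · simp [split, ret_map]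
    · simp [split, ret_map]
  have hinl : coprod.inl ≫ E.iter (d ≫ T.map split) =
      (a ≫ kl T (coprod.desc (b ≫ kl T (coprod.desc (ret T Y) (E.iter c)) ≫ T.map coprod.inl)
        (coprod.inr ≫ ret T (Y ⨿ A)))) ≫ T.map (coprod.map (𝟙 Y) coprod.inl) := by
    rw [← E.fixpoint, hd]
    simp only [coprod.inl_desc_assoc, Category.assoc, map_kl, kl_kl, kl_map]
    congr 2
    apply coprod.hom_ext
    · simp only [coprod.inl_desc_assoc, Category.assoc, map_kl, kl_map]
      congr 2
      apply coprod.hom_ext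
      · simp [split, ret_map, ← Functor.map_comp]
      · simp [split, ← hd, hinr, ← Functor.map_comp]
    · simp [split, ret_map]
  rw [hdw, E.codiagonal, E.uniformity _ _ _ hinl, E.naturality]
  simp

variable [Iteratable T.toFunctor]

/-- The components `ρ = out† : T^ν X ⟶ T X` of the algebra structure of an Elgot monad. -/
def iterOut (X : C) : nuObj T.toFunctor X ⟶ T.obj X := E.iter (out T.toFunctor X)

theorem iterOut_eq (X : C) :
    iterOut E X = out T.toFunctor X ≫ kl T (coprod.desc (ret T X) (iterOut E X)) :=
  (E.fixpoint _).symm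

theorem coit_iterOut {X A : C} (f : A ⟶ T.obj (X ⨿ A)) :
    coit (F := T.toFunctor) f ≫ iterOut E X = E.iter f :=
  E.uniformity _ _ _ (coit_out (F := T.toFunctor) f)

theorem nuUnit_iterOut (X : C) : nuUnit T X ≫ iterOut E X = ret T X := by
  rw [iterOut_eq, reassoc_of% @nuUnit_out]
  simp

theorem metaUnit_iterOut (X : C) : metaUnit T X ≫ iterOut E X = 𝟙 _ := by
  rw [iterOut_eq, reassoc_of% @metaUnit_out, map_kl, coprod.inl_desc, kl_ret]

theorem delay_iterOut (X : C) : delay T X ≫ iterOut E X = iterOut E X := by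
  conv_lhs => rw [iterOut_eq, reassoc_of% @delay_out]
  simp

theorem nuBind_iterOut {X Y : C} (f : X ⟶ nuObj T.toFunctor Y) :
    nuBind T f ≫ iterOut E Y = iterOut E X ≫ kl T (f ≫ iterOut E Y) := by
  rw [nuBind, Category.assoc, coit_iterOut]
  have h := iter_comp_iter E (out T.toFunctor X) (f ≫ out T.toFunctor Y) (out T.toFunctor Y)
  simp only [Category.assoc] at h
  rw [← h]
  change E.iter (out T.toFunctor X) ≫ kl T (f ≫ out T.toFunctor Y ≫
    kl T (coprod.desc (ret T Y) (iterOut E Y))) = _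
  rw [← iterOut_eq]
  rfl

/-- The structure morphism `T^ν ⟶ T` of an Elgot monad as a monad morphism. -/
def iterOutHom : nuMonad T ⟶ T :=
  homOfKl (T := nuMonad T) (iterOut E) (nuUnit_iterOut E) fun f =>
    (congrArg (· ≫ iterOut E _) (kl_nuMonad T f)).trans (nuBind_iterOut E f)

theorem metaMult_iterOut [Iteratable (nuMonad T).toFunctor] (X : C) :
    metaMult T X ≫ iterOut E X = nuHomApp (iterOutHom E) X ≫ iterOut E X := by
  -- the loop whose iterate is `ρ ∘ out`
  let g : nuObj (nuMonad T).toFunctor X ⟶ T.obj ((X ⨿ nuObj (nuMonad T).toFunctor X) ⨿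
      nuObj (nuMonad T).toFunctor X) :=
    outNu T X ≫ out T.toFunctor _ ≫ T.map (coprod.map (𝟙 _) (tuoNu T X))
  have hg : outNu T X ≫ iterOut E _ = E.iter g := by
    apply E.uniformity
    simp [g, ← Functor.map_comp, tuoNu_outNu]
  have h1 : nuHomApp (iterOutHom E) X ≫ iterOut E X = E.iter (outNu T X ≫ iterOut E _) :=
    coit_iterOut E _
  have h2 : metaMult T X ≫ iterOut E X = E.iter (outNu T X ≫ out T.toFunctor _ ≫
      T.map (coprod.desc (𝟙 _) (tuoNu T X ≫ coprod.inr))) := coit_iterOut E _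
  rw [h1, h2, hg, ← E.codiagonal]
  simp [g, ← Functor.map_comp]

theorem iterOut_hom {S : Monad C} [Iteratable S.toFunctor] (E' : ElgotStructure S) (α : T ⟶ S)
    (hα : ∀ {X Y : C} (f : X ⟶ T.obj (Y ⨿ X)), E.iter f ≫ α.app Y = E'.iter (f ≫ α.app (Y ⨿ X)))
    (X : C) : nuHomApp α X ≫ iterOut E' X = iterOut E X ≫ α.app X :=
  (coit_iterOut E' _).trans (hα _).symm

end Elgot

/-! ### From algebras to iteration operators -/

section Algebra

variable {T : Monad C} [Iteratable T.toFunctor] (ρ : nuMonad T ⟶ T)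

/-- The components of a monad morphism `T^ν ⟶ T`, typed by the carrier of `T^ν`. -/
def strApp (X : C) : nuObj T.toFunctor X ⟶ T.obj X := ρ.app X

/-- The iteration operator `f ↦ ρ ∘ coit f` of a `(-)^ν`-algebra. -/
def algIter {X Y : C} (f : X ⟶ T.obj (Y ⨿ X)) : X ⟶ T.obj Y :=
  coit (F := T.toFunctor) f ≫ strApp ρ Y

theorem nuUnit_strApp (X : C) : nuUnit T X ≫ strApp ρ X = ret T X := ρ.app_η X

theorem nuBind_strApp {X Y : C} (f : X ⟶ nuObj T.toFunctor Y) :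
    nuBind T f ≫ strApp ρ Y = strApp ρ X ≫ kl T (f ≫ strApp ρ Y) :=
  (congrArg (· ≫ strApp ρ Y) (kl_nuMonad T f)).symm.trans (hom_kl ρ f)

theorem tuo_strApp (hunit : ∀ X, metaUnit T X ≫ strApp ρ X = 𝟙 _)
    (hcancel : ∀ X, delay T X ≫ strApp ρ X = strApp ρ X) (X : C) :
    tuo T.toFunctor X ≫ strApp ρ X = kl T (coprod.desc (ret T X) (strApp ρ X)) := by
  rw [tuo_eq, Category.assoc, nuBind_strApp, reassoc_of% @hunit]
  congr 1
  apply coprod.hom_ext <;> simp [nuUnit_strApp, hcancel]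

theorem algIter_fixpoint (hunit : ∀ X, metaUnit T X ≫ strApp ρ X = 𝟙 _)
    (hcancel : ∀ X, delay T X ≫ strApp ρ X = strApp ρ X) {X Y : C} (f : X ⟶ T.obj (Y ⨿ X)) :
    f ≫ kl T (coprod.desc (ret T Y) (algIter ρ f)) = algIter ρ f := by
  have h : coit (F := T.toFunctor) f =
      f ≫ T.map (coprod.map (𝟙 Y) (coit (F := T.toFunctor) f)) ≫ tuo T.toFunctor Y := by
    apply out_cancel
    simp [coit_out (F := T.toFunctor) f]
  conv_rhs => rw [algIter, h]
  rw [Category.assoc, Category.assoc, tuo_strApp ρ hunit hcancel, map_kl]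
  congr 2
  apply coprod.hom_ext <;> simp [algIter]

theorem coit_nuBind {X Y Z : C} (f : X ⟶ T.obj (Y ⨿ X)) (g : Y ⟶ T.obj Z) :
    coit (F := T.toFunctor) f ≫ nuBind T (g ≫ metaUnit T Z) =
      coit (F := T.toFunctor)
        (f ≫ kl T (coprod.desc (g ≫ T.map coprod.inl) (coprod.inr ≫ ret T (Z ⨿ X)))) := by
  apply coit_unique (F := T.toFunctor)
  rw [Category.assoc, nuBind_out, reassoc_of% (coit_out (F := T.toFunctor) f), map_kl]
  simp only [Category.assoc, kl_map]
  congr 2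
  apply coprod.hom_ext
  · simp [metaUnit_out, ← Functor.map_comp]
  · simp [ret_map]

theorem algIter_naturality (hunit : ∀ X, metaUnit T X ≫ strApp ρ X = 𝟙 _) {X Y Z : C}
    (f : X ⟶ T.obj (Y ⨿ X)) (g : Y ⟶ T.obj Z) :
    algIter ρ f ≫ kl T g =
      algIter ρ
        (f ≫ kl T (coprod.desc (g ≫ T.map coprod.inl) (coprod.inr ≫ ret T (Z ⨿ X)))) := by
  rw [algIter, algIter, ← coit_nuBind, Category.assoc, Category.assoc, nuBind_strApp,
    Category.assoc, hunit, Category.comp_id]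

theorem algIter_uniformity {X Y Z : C} (f : X ⟶ T.obj (Y ⨿ X)) (g : Z ⟶ T.obj (Y ⨿ Z))
    (h : Z ⟶ X) (w : h ≫ f = g ≫ T.map (coprod.map (𝟙 Y) h)) :
    h ≫ algIter ρ f = algIter ρ g := by
  have : h ≫ coit (F := T.toFunctor) f = coit (F := T.toFunctor) g := by
    apply coit_unique (F := T.toFunctor)
    rw [Category.assoc, coit_out, reassoc_of% w, ← Functor.map_comp]
    simp
  rw [algIter, algIter, ← this, Category.assoc]

theorem algIter_out (X : C) : algIter ρ (out T.toFunctor X) = strApp ρ X := by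
  have : coit (F := T.toFunctor) (out T.toFunctor X) = 𝟙 _ :=
    (coit_unique (F := T.toFunctor) _ _ (by simp)).symm
  rw [algIter, this, Category.id_comp]

theorem algIter_hom {S : Monad C} [Iteratable S.toFunctor] (σ : nuMonad S ⟶ S) (α : T ⟶ S)
    (hα : ∀ X, nuHomApp α X ≫ strApp σ X = strApp ρ X ≫ α.app X) {X Y : C}
    (f : X ⟶ T.obj (Y ⨿ X)) :
    algIter ρ f ≫ α.app Y = algIter σ (f ≫ α.app (Y ⨿ X)) := by
  have : coit (F := T.toFunctor) f ≫ nuHomApp α Y =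
      coit (F := S.toFunctor) (f ≫ α.app (Y ⨿ X)) := by
    apply coit_unique (F := S.toFunctor)
    rw [Category.assoc, nuHomApp_out, reassoc_of% (coit_out (F := T.toFunctor) f),
      α.naturality_assoc, ← Functor.map_comp, Category.assoc]
    simp
  rw [algIter, algIter, ← this, Category.assoc, Category.assoc, hα]

variable [Iteratable (nuMonad T).toFunctor]

/-- The multiplication of `(-)^ν` flattens a nested coiteration to the coiteration of the merged
loop; this is what turns associativity of an algebra into the codiagonal law. -/
theorem coit_coit_metaMult {X Y : C} (f : X ⟶ T.obj ((Y ⨿ X) ⨿ X)) :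
    coit (F := (nuMonad T).toFunctor) (X := Y) (coit (F := T.toFunctor) f) ≫ metaMult T Y =
      coit (F := T.toFunctor) (f ≫ T.map (coprod.desc (𝟙 (Y ⨿ X)) coprod.inr)) := by
  set c : X ⟶ nuObj (nuMonad T).toFunctor Y :=
    coit (F := (nuMonad T).toFunctor) (X := Y) (coit (F := T.toFunctor) f) with hc
  have hout : c ≫ outNu T Y =
      coit (F := T.toFunctor) f ≫ nuMap T.toFunctor (coprod.map (𝟙 Y) c) :=
    coit_outNu T (coit (F := T.toFunctor) f)
  have htuo : coit (F := T.toFunctor) f ≫ nuMap T.toFunctor (coprod.map (𝟙 Y) c) ≫ tuoNu T Y =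
      c := by
    rw [← reassoc_of% hout, outNu_tuoNu, Category.comp_id]
  apply coit_unique (F := T.toFunctor)
  rw [Category.assoc, metaMult_out, reassoc_of% hout, reassoc_of% @nuMap_out,
    reassoc_of% (coit_out (F := T.toFunctor) f), Category.assoc]
  simp only [← Functor.map_comp]
  congr 2
  apply coprod.hom_ext
  · simp
  · simp [reassoc_of% htuo]

theorem coit_nuHomApp {X Y : C} (f : X ⟶ nuObj T.toFunctor (Y ⨿ X)) :
    coit (F := (nuMonad T).toFunctor) (X := Y) f ≫ nuHomApp ρ Y =
      coit (F := T.toFunctor) (f ≫ strApp ρ _) := by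
  apply coit_unique (F := T.toFunctor)
  have hn : ∀ {A B : C} (g : A ⟶ B), nuMap T.toFunctor g ≫ strApp ρ B = strApp ρ A ≫ T.map g :=
    fun g => ρ.naturality g
  have hout : nuHomApp ρ Y ≫ out T.toFunctor Y =
      outNu T Y ≫ strApp ρ _ ≫ T.map (coprod.map (𝟙 Y) (nuHomApp ρ Y)) := nuHomApp_out ρ Y
  rw [Category.assoc, hout, reassoc_of% @coit_outNu, reassoc_of% @hn, ← Functor.map_comp,
    Category.assoc]
  simp

/-- The Elgot structure of a delay-cancelling `(-)^ν`-algebra. -/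
def algElgot (hunit : ∀ X, metaUnit T X ≫ strApp ρ X = 𝟙 _)
    (hmult : ∀ X, metaMult T X ≫ strApp ρ X = nuHomApp ρ X ≫ strApp ρ X)
    (hcancel : ∀ X, delay T X ≫ strApp ρ X = strApp ρ X) : ElgotStructure T where
  iter := algIter ρ
  fixpoint := algIter_fixpoint ρ hunit hcancel
  naturality := algIter_naturality ρ hunit
  codiagonal f := by
    rw [algIter, ← coit_coit_metaMult, Category.assoc, hmult, ← Category.assoc, coit_nuHomApp]
    rfl
  uniformity := algIter_uniformity ρ

end Algebra

/-! ### The monad on the category of iteratable monads -/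

variable (C) in
/-- The unit of `(-)^ν`. -/
def nuEta : 𝟭 (OmegaMonad C) ⟶ nu C where
  app S := ObjectProperty.homMk (metaUnitHom S.obj)
  naturality S T α := by
    ext X
    exact (metaUnit_homApp α.hom X).symm

variable (C) in
/-- The multiplication of `(-)^ν`. -/
def nuMu : nu C ⋙ nu C ⟶ nu C where
  app S := ObjectProperty.homMk (metaMultHom S.obj)
  naturality S T α := by
    ext X
    exact metaMult_homApp α.hom X

theorem nuMu_assoc (S : OmegaMonad C) :
    (nu C).map ((nuMu C).app S) ≫ (nuMu C).app S =
      (nuMu C).app ((nu C).obj S) ≫ (nuMu C).app S := by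
  have : Iteratable (nuMonad (nuMonad S.obj)).toFunctor :=
    (nuOmega (nuOmega S)).property.iteratable
  ext X
  exact metaMult_assoc S.obj X

theorem nuEta_nuMu (S : OmegaMonad C) :
    (nuEta C).app ((nu C).obj S) ≫ (nuMu C).app S = 𝟙 ((nu C).obj S) := by
  ext X
  exact metaUnit_metaMult S.obj X

theorem map_nuEta_nuMu (S : OmegaMonad C) :
    (nu C).map ((nuEta C).app S) ≫ (nuMu C).app S = 𝟙 ((nu C).obj S) := by
  ext X
  exact metaUnitHom_metaMult S.obj X

variable (C) in
/-- The monad `(-)^ν` on the category of `ω`-iteratable monads. -/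
abbrev resumptionMonad : Monad (OmegaMonad C) :=
  nuMonadOf (nuEta C) (nuMu C) nuMu_assoc nuEta_nuMu map_nuEta_nuMu

variable (C) in
/-- The category of `(-)^ν`-algebras that satisfy delay cancellation. -/
abbrev DelayAlgebra :=
  ObjectProperty.FullSubcategory (fun A : (resumptionMonad C).Algebra => CancelsDelay A.a)

/-! ### The isomorphism of categories -/

/-- The structure morphism `ρ = out†` of an `ω`-iteratable Elgot monad. -/
def elgotStr (E : OmegaElgot C) : (nu C).obj E.toOmega ⟶ E.toOmega :=
  ObjectProperty.homMk (iterOutHom E.elgot)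

/-- The delay-cancelling algebra of an Elgot monad. -/
def toDelayAlgebra (E : OmegaElgot C) : DelayAlgebra C where
  obj :=
    { A := E.toOmega
      a := elgotStr E
      unit := by
        ext X
        exact metaUnit_iterOut E.elgot X
      assoc := by
        ext X
        exact metaMult_iterOut E.elgot X }
  property := delay_iterOut E.elgot

/-- The Elgot monad of a delay-cancelling algebra. -/
def ofDelayAlgebra (A : DelayAlgebra C) : OmegaElgot C where
  toOmega := A.obj.A
  elgot := algElgot A.obj.a.hom
    (fun X => congrArg (fun f : A.obj.A ⟶ A.obj.A => f.hom.app X) A.obj.unit)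
    (fun X => congrArg (fun f : (nu C).obj ((nu C).obj A.obj.A) ⟶ A.obj.A => f.hom.app X)
      A.obj.assoc)
    A.property

theorem ofDelayAlgebra_toDelayAlgebra (E : OmegaElgot C) :
    ofDelayAlgebra (toDelayAlgebra E) = E := by
  have : (ofDelayAlgebra (toDelayAlgebra E)).elgot = E.elgot := by
    apply ElgotStructure.ext
    funext X Y f
    exact coit_iterOut E.elgot f
  exact congrArg (OmegaElgot.mk E.toOmega) this

theorem toDelayAlgebra_ofDelayAlgebra (A : DelayAlgebra C) :
    toDelayAlgebra (ofDelayAlgebra A) = A := by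
  obtain ⟨⟨S, a, hu, ha⟩, hc⟩ := A
  have : elgotStr (ofDelayAlgebra ⟨⟨S, a, hu, ha⟩, hc⟩) = a := by
    ext X
    exact algIter_out a.hom X
  simp only [toDelayAlgebra]
  congr 2

variable (C) in
/-- The comparison functor from Elgot monads to algebras. -/
def elgotToAlgebra : OmegaElgot C ⥤ DelayAlgebra C where
  obj := toDelayAlgebra
  map {E E'} α := ObjectProperty.homMk
    { f := α.hom
      h := by
        ext X
        exact iterOut_hom E.elgot E'.elgot α.hom.hom α.preserves X }

variable (C) in
/-- The comparison functor from algebras to Elgot monads. -/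
def algebraToElgot : DelayAlgebra C ⥤ OmegaElgot C where
  obj := ofDelayAlgebra
  map {A B} α :=
    { hom := α.hom.f
      preserves := fun f => algIter_hom A.obj.a.hom B.obj.a.hom α.hom.f.hom
        (fun X => congrArg (fun g : (nu C).obj A.obj.A ⟶ B.obj.A => g.hom.app X) α.hom.h) f }

theorem OmegaElgot.eqToHom_hom {E E' : OmegaElgot C} (h : E = E') :
    (eqToHom h).hom = eqToHom (congrArg OmegaElgot.toOmega h) := by
  subst h
  rfl

theorem DelayAlgebra.eqToHom_hom_f {A B : DelayAlgebra C} (h : A = B) :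
    (eqToHom h).hom.f = eqToHom (congrArg (fun A : DelayAlgebra C => A.obj.A) h) := by
  subst h
  rfl

theorem elgot_unit_eq : 𝟭 (OmegaElgot C) = elgotToAlgebra C ⋙ algebraToElgot C := by
  refine CategoryTheory.Functor.ext (fun E => (ofDelayAlgebra_toDelayAlgebra E).symm) fun E E' α => ?_
  apply OmegaElgot.Hom.ext
  change α.hom = (eqToHom (ofDelayAlgebra_toDelayAlgebra E).symm).hom ≫ α.hom ≫
    (eqToHom (ofDelayAlgebra_toDelayAlgebra E')).hom
  rw [OmegaElgot.eqToHom_hom, OmegaElgot.eqToHom_hom]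
  exact ((Category.id_comp _).trans (Category.comp_id _)).symm

theorem elgot_counit_eq : algebraToElgot C ⋙ elgotToAlgebra C = 𝟭 (DelayAlgebra C) := by
  refine CategoryTheory.Functor.ext toDelayAlgebra_ofDelayAlgebra fun A B α => ?_
  apply ObjectProperty.hom_ext
  apply Monad.Algebra.Hom.ext
  change _ = (eqToHom (toDelayAlgebra_ofDelayAlgebra A)).hom.f ≫ α.hom.f ≫
    (eqToHom (toDelayAlgebra_ofDelayAlgebra B).symm).hom.f
  rw [DelayAlgebra.eqToHom_hom_f, DelayAlgebra.eqToHom_hom_f]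
  exact ((Category.id_comp _).trans (Category.comp_id _)).symm

variable (C) in
/-- The isomorphism between Elgot monads and delay-cancelling algebras. -/
def elgotIsoAlgebra : IsoCat (OmegaElgot C) (DelayAlgebra C) where
  functor := elgotToAlgebra C
  inverse := algebraToElgot C
  unit_eq := elgot_unit_eq
  counit_eq := elgot_counit_eq

end NuAlg

end

theorem theorem5p13 {C : Type u} [Category.{v} C] [HasFiniteCoproducts C] :
    ∃ (η : 𝟭 (NuAlg.OmegaMonad C) ⟶ NuAlg.nu C)
      (μ : NuAlg.nu C ⋙ NuAlg.nu C ⟶ NuAlg.nu C)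
      (assoc : ∀ S, (NuAlg.nu C).map (μ.app S) ≫ μ.app S = μ.app ((NuAlg.nu C).obj S) ≫ μ.app S)
      (left_unit : ∀ S, η.app ((NuAlg.nu C).obj S) ≫ μ.app S = 𝟙 ((NuAlg.nu C).obj S))
      (right_unit : ∀ S, (NuAlg.nu C).map (η.app S) ≫ μ.app S = 𝟙 ((NuAlg.nu C).obj S)),
      (∀ (S : NuAlg.OmegaMonad C) (X : C), (η.app S).hom.app X = NuAlg.metaUnit S.obj X) ∧
      (∀ (S : NuAlg.OmegaMonad C) (X : C), (μ.app S).hom.app X = NuAlg.metaMult S.obj X) ∧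
      ∃ Φ : IsoCat (NuAlg.OmegaElgot C)
          (ObjectProperty.FullSubcategory
            (fun A : (NuAlg.nuMonadOf η μ assoc left_unit right_unit).Algebra =>
              NuAlg.CancelsDelay A.a)),
        (∀ E : NuAlg.OmegaElgot C,
          ∃ (ρ : (NuAlg.nu C).obj E.toOmega ⟶ E.toOmega)
            (unit : η.app E.toOmega ≫ ρ = 𝟙 E.toOmega)
            (mult : μ.app E.toOmega ≫ ρ = (NuAlg.nu C).map ρ ≫ ρ)
            (cancel : NuAlg.CancelsDelay ρ),
            (∀ X : C, ρ.hom.app X = E.elgot.iter (NuAlg.out E.toOmega.obj.toFunctor X)) ∧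
            Φ.functor.obj E = ⟨⟨E.toOmega, ρ, unit, mult⟩, cancel⟩) ∧
        Φ.functor ⋙ ObjectProperty.ι (fun A :
            (NuAlg.nuMonadOf η μ assoc left_unit right_unit).Algebra => NuAlg.CancelsDelay A.a) ⋙
          Monad.forget (NuAlg.nuMonadOf η μ assoc left_unit right_unit) =
            NuAlg.OmegaElgot.forget C := by
  refine ⟨NuAlg.nuEta C, NuAlg.nuMu C, NuAlg.nuMu_assoc, NuAlg.nuEta_nuMu, NuAlg.map_nuEta_nuMu,
    fun _ _ => rfl, fun _ _ => rfl, NuAlg.elgotIsoAlgebra C, fun E => ?_, rfl⟩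
  exact ⟨NuAlg.elgotStr E, (NuAlg.toDelayAlgebra E).obj.unit, (NuAlg.toDelayAlgebra E).obj.assoc,
    (NuAlg.toDelayAlgebra E).property, fun _ => rfl, rfl⟩
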